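/- **Setting.** Let $X\neq\emptyset$ and $D$ be second countable, locally compact Hausdorff spaces. A hypergroup $(D,*)$ has a bilinear, associative, weakly continuous convolution $*$ of bounded Borel measures such that the measures $\delta_x*\delta_y$ are compactly supported probability measures with $(x,y)\mapsto \operatorname{supp}(\delta_x*\delta_y)$ continuous for the Hausdorff (Michael) topology, a neutral element $e$ with $\delta_x*\delta_e=\delta_e*\delta_x=\delta_x$, and a continuous involution $x\mapsto\bar x$ such that $e\in\operatorname{supp}(\delta_x*\delta_y)\iff y=\bar x$, and such that the image of $\delta_x*\delta_y$ under the involution is $\delta_{\bar y}*\delta_{\bar x}$. We write $f(x*y)=\int f\,d(\delta_x*\delta_y)$. A continuous association scheme (CAS) $(X,D,K)$ with associated hypergroup $(D,*)$ is a Markov kernel $K$ from $X\times D$ to $X$, with $K_h(x,\cdot):=K((x,h),\cdot)$ and $T_hf(x):=\int f\,dK_h(x,\cdot)$, such that: (0) $(x,h)\mapsto T_hf(x)$ is continuous for every $f\in C_b(X)$; (1) the supports $\operatorname{supp}K_h(x,\cdot)$ are compact and depend continuously on $(x,h)$ for the Hausdorff topology; (2) for each $x$ the sets $\operatorname{supp}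 K_h(x,\cdot)$, $h\in D$, form a partition of $X$, and the map $\pi:X\times X\to D$ with $y\in\operatorname{supp}K_{\pi(x,y)}(x,\cdot)$ is continuous (write $\pi_x=\pi(x,\cdot)$); (3) $\int_X K_{h_2}(y,A)\,K_{h_1}(x,dy)=\int_D K_h(x,A)\,d(\delta_{h_1}*\delta_{h_2})(h)$ for all $h_1,h_2\in D$, $x\in X$ and Borel sets $A$, and $K_e(x,\cdot)=\delta_x$; (4) there is an invariant measure, i.e. a positive Radon measure $\omega_X$ on $X$ with $\operatorname{supp}\omega_X=X$ and $\int T_{\bar h}f\cdot g\,d\omega_X=\int f\cdot T_hg\,d\omega_X$ for all $h\in D$, $f,g\in C_c(X)$. The CAS is commutative if $*$ is. It has property (T1) at $z\in X$ if $f_h\circ\pi_z=T_h(f\circ\pi_z)$ for all $h\in D$ and $f\in C_c(D)$, where $f_h(l)=f(l*h)$; it has (T1) if this holds for all $z\in X$. A positive semicharacter of a commutative CAS is a pair of continuous functions $\alpha_0:D\to\,]0,\infty[$, $\varphi_0:X\to\,]0,\infty[$ with $T_h\varphi_0=\alpha_0(h)\varphi_0$ and $\alpha_0(\bar h)=\alpha_0(h)$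 for all $h\in D$. A positive semicharacter of $(D,*)$ is a continuous $\alpha_0:D\to\,]0,\infty[$ with $\alpha_0(x*y)=\alpha_0(x)\alpha_0(y)$ and $\alpha_0(\bar x)=\alpha_0(x)$ for all $x,y\in D$. **Proposition 8.6.** Let $(X,D,K)$ be a commutative CAS with hypergroup $(D,*)$ and projection $\pi$. Let $(\alpha_0,\varphi_0)$ be a positive semicharacter of $(X,D,K)$. Define the deformed convolution $$\delta_{h_1}\tilde*\,\delta_{h_2}:=\frac{\alpha_0}{\alpha_0(h_1)\alpha_0(h_2)}\cdot(\delta_{h_1}*\delta_{h_2})\qquad(h_1,h_2\in D),$$ with the identity and the involution of $(D,*)$, and the deformed kernels $$\tilde K_h(x,A):=\frac{1}{\alpha_0(h)\varphi_0(x)}\int_A\varphi_0(y)\,K_h(x,dy)\qquad(h\in D,\ x\in X,\ A\in\mathcal B(X)).$$ Then $(D,\tilde*)$ is a commutative hypergroup, and $(X,D,\tilde K)$ is a commutative CAS with associated hypergroup $(D,\tilde*)$ and the same projection $\pi$. Moreover: (1) If $\omega_X$ is an invariant measure of $(X,D,K)$, then $\varphi_0^2\cdot\omega_X$ is an invariant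 measure of $(X,D,\tilde K)$. (2) Assume that $(X,D,K)$ has property (T1). Let $\alpha_0$ be a positive semicharacter of $(D,*)$ and $z\in X$. Then $(\alpha_0,\alpha_0\circ\pi_z)$ is a positive semicharacter of $(X,D,K)$. For the corresponding deformations $\tilde*$ and $\tilde K$, with operators $\tilde T_h$, one has $$f(h\,\tilde*\,\pi_z(y))=\tilde T_h(f\circ\pi_z)(y)\qquad(f\in C(D),\ h\in D,\ y\in X),$$ and in particular $(X,D,\tilde K)$ has property (T1) at $z$. -/

import Mathlib

open MeasureTheory ProbabilityTheory
open scoped ENNReal BoundedContinuousFunction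

/-- A kernel `κ` is continuous if its transition operator `f ↦ ∫ f(t) κ(·, dt)` maps bounded continuous
functions to (bounded) continuous functions. -/
def IsContinuousKernel {S T : Type*} [TopologicalSpace S] [MeasurableSpace S]
    [TopologicalSpace T] [MeasurableSpace T] (κ : Kernel S T) : Prop :=
  ∀ f : T →ᵇ ℂ, Continuous fun s => ∫ t, f t ∂(κ s)

/-- All the measures `κ(s, ·)` have compact support, and `s ↦ supp κ(s, ·)` is a continuous map into the
space of compact subsets of `T` (which carries in Mathlib the Vietoris topology, that is, the Michael
topology or, for any compatible metric, the topology of the Hausdorff metric). -/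
def HasContinuousCompactSupports {S T : Type*} [TopologicalSpace S] [MeasurableSpace S]
    [TopologicalSpace T] [MeasurableSpace T] (κ : Kernel S T) : Prop :=
  ∃ c : S → TopologicalSpace.Compacts T, Continuous c ∧ ∀ s, (c s : Set T) = (κ s).support

/-- The data of a hypergroup on `D`: the convolutions `conv (x, y) = δ_x * δ_y` of point measures, the neutral
element, and the involution. The axioms are in `HypergroupData.IsHypergroup`.

A bilinear weakly continuous convolution of bounded complex measures is determined by its values at
point measures, by `μ * ν = ∫∫ δ_x * δ_y dμ(x) dν(y)`, and conversely this formula extends any weakly continuous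
family of probability measures `δ_x * δ_y` to such a convolution. -/
structure HypergroupData (D : Type*) [MeasurableSpace D] where
  conv : Kernel (D × D) D
  one : D
  inv : D → D

namespace HypergroupData

variable {D : Type*} [TopologicalSpace D] [MeasurableSpace D]

/-- The convolution `μ * ν = ∫∫ δ_x * δ_y dμ(x) dν(y)` of measures. -/
noncomputable def mul (H : HypergroupData D) (μ ν : Measure D) : Measure D :=
  (μ.prod ν).bind H.conv

/-- The axioms of a hypergroup. (Every bounded complex measure is a linear combination of
finite positive measures, so associativity for the latter is associativity on all bounded measures.) -/
structure IsHypergroup (H : HypergroupData D) : Prop where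
  isMarkov : IsMarkovKernel H.conv
  weakly_continuous : IsContinuousKernel H.conv
  assoc : ∀ (μ ν ρ : Measure D) [IsFiniteMeasure μ] [IsFiniteMeasure ν] [IsFiniteMeasure ρ],
    H.mul (H.mul μ ν) ρ = H.mul μ (H.mul ν ρ)
  compact_supports : HasContinuousCompactSupports H.conv
  conv_one : ∀ x, H.conv (x, H.one) = Measure.dirac x
  one_conv : ∀ x, H.conv (H.one, x) = Measure.dirac x
  inv_continuous : Continuous H.inv
  inv_inv : ∀ x, H.inv (H.inv x) = x
  one_mem_support_iff : ∀ x y, H.one ∈ (H.conv (x, y)).support ↔ y = H.inv x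
  conv_map_inv : ∀ x y, (H.conv (x, y)).map H.inv = H.conv (H.inv y, H.inv x)

/-- Commutativity of the convolution. -/
def IsCommutative (H : HypergroupData D) : Prop :=
  ∀ (μ ν : Measure D) [IsFiniteMeasure μ] [IsFiniteMeasure ν], H.mul μ ν = H.mul ν μ

/-- `α` is a positive semicharacter of the hypergroup: a continuous, `]0, ∞[`-valued function with
`α(x * y) = α(x) α(y)` and `α(x̄) = α(x)` (the complex conjugate of `α(x)`, which is real). -/
structure IsPositiveSemicharacter (H : HypergroupData D) (α : D → ℝ) : Prop where
  continuous : Continuous α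
  pos : ∀ x, 0 < α x
  multiplicative : ∀ x y, ∫ t, α t ∂(H.conv (x, y)) = α x * α y
  inv : ∀ x, α (H.inv x) = α x

/-- The deformation of a hypergroup by a positive function `α`:
`δ_x *~ δ_y = α / (α(x) α(y)) · (δ_x * δ_y)`, with the same neutral element and the same involution. -/
noncomputable def deform (H : HypergroupData D) [IsMarkovKernel H.conv] (α : D → ℝ) :
    HypergroupData D where
  conv := H.conv.withDensity fun p t => ENNReal.ofReal (α t / (α p.1 * α p.2))
  one := H.one
  inv := H.inv

end HypergroupData

section Scheme

variable {X D : Type*} [TopologicalSpace X] [MeasurableSpace X]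
  [TopologicalSpace D] [MeasurableSpace D]

/-- `ω` is an invariant measure of a scheme with kernels `K_h = K(·, h; ·)`: a positive Radon measure with full
support such that `∫ T_{h̄} f · g dω = ∫ f · T_h g dω` for all `h` and all `f, g ∈ C_c(X)`,
where `T_h f(x) = ∫ f(y) K_h(x, dy)`. -/
structure IsInvariantMeasure (H : HypergroupData D) (K : Kernel (X × D) X) (ω : Measure X) :
    Prop where
  regular : ω.Regular
  support_eq : ω.support = Set.univ
  adjoint : ∀ (h : D) (f g : X → ℂ), Continuous f → HasCompactSupport f →
    Continuous g → HasCompactSupport g →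
    ∫ x, (∫ y, f y ∂(K (x, H.inv h))) * g x ∂ω = ∫ x, f x * (∫ y, g y ∂(K (x, h))) ∂ω

/-- `(X, D, K)` is a continuous association scheme with associated hypergroup `H` and with projection
`π : X × X → D`. The hypergroup and the projection are determined by `K`. -/
structure IsCAS (H : HypergroupData D) (K : Kernel (X × D) X) (π : X → X → D) : Prop where
  isMarkov : IsMarkovKernel K
  isContinuous : IsContinuousKernel K
  compact_supports : HasContinuousCompactSupports K
  /-- For each `x`, the sets `supp K(x, h; ·)`, `h ∈ D`, form a partition of `X`: the point `y` lies in the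
  set with index `h = π x y` and in no other one. -/
  partition : ∀ x y h, y ∈ (K (x, h)).support ↔ h = π x y
  continuous_proj : Continuous fun p : X × X => π p.1 p.2
  isHypergroup : H.IsHypergroup
  /-- `(K_{h₁} ∘ K_{h₂})(x, A) = ∫ K_h(x, A) d(δ_{h₁} * δ_{h₂})(h)`. -/
  comp_eq : ∀ (h₁ h₂ : D) (x : X) (A : Set X), MeasurableSet A →
    ∫⁻ y, K (y, h₂) A ∂(K (x, h₁)) = ∫⁻ h, K (x, h) A ∂(H.conv (h₁, h₂))
  kernel_one : ∀ x, K (x, H.one) = Measure.dirac x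
  exists_invariant : ∃ ω : Measure X, IsInvariantMeasure H K ω

/-- A multiplicative pair `(α, φ)`: continuous functions with `α ≢ 0` and `T_h φ = α(h) φ` for all `h`. -/
structure IsMultiplicativePair (K : Kernel (X × D) X) (α : D → ℂ) (φ : X → ℂ) : Prop where
  continuous_left : Continuous α
  continuous_right : Continuous φ
  ne_zero : α ≠ 0
  eigen : ∀ h x, ∫ y, φ y ∂(K (x, h)) = φ x * α h

/-- A semicharacter: a multiplicative pair `(α, φ)` such that `α(h̄)` is the complex conjugate of `α(h)`. -/
structure IsSemicharacter (H : HypergroupData D) (K : Kernel (X × D) X) (α : D → ℂ) (φ : X → ℂ) :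
    Prop extends IsMultiplicativePair K α φ where
  inv : ∀ h, α (H.inv h) = star (α h)

/-- A positive semicharacter: a semicharacter `(α, φ)` with `]0, ∞[`-valued functions `α` and `φ`. -/
structure IsPositiveSemicharacter (H : HypergroupData D) (K : Kernel (X × D) X)
    (α : D → ℝ) (φ : X → ℝ) : Prop where
  semicharacter : IsSemicharacter H K (fun h => (α h : ℂ)) (fun x => (φ x : ℂ))
  pos_left : ∀ h, 0 < α h
  pos_right : ∀ x, 0 < φ x

/-- The deformed kernel `K~_h(x, A) = (α(h) φ(x))⁻¹ ∫_A φ(y) K_h(x, dy)`. -/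
noncomputable def deformKernel (K : Kernel (X × D) X) [IsMarkovKernel K] (α : D → ℝ) (φ : X → ℝ) :
    Kernel (X × D) X :=
  K.withDensity fun p y => ENNReal.ofReal (φ y / (α p.2 * φ p.1))

/-- The translation property (T1) at the base point `z`: for all `h ∈ D` and `f ∈ C_c(D)`,
`f_h ∘ π_z = T_h (f ∘ π_z)`, where `f_h(l) = f(l * h) = ∫ f d(δ_l * δ_h)` and `π_z = π(z, ·)`. -/
def HasT1At (H : HypergroupData D) (K : Kernel (X × D) X) (π : X → X → D) (z : X) : Prop :=
  ∀ (h : D) (f : D → ℂ), Continuous f → HasCompactSupport f →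
    ∀ y, ∫ t, f t ∂(H.conv (π z y, h)) = ∫ w, f (π z w) ∂(K (y, h))

/-- The translation property (T1). -/
def HasT1 (H : HypergroupData D) (K : Kernel (X × D) X) (π : X → X → D) : Prop :=
  ∀ z, HasT1At H K π z

end Scheme

/-- The deformed convolution of point measures is given by the formula it is meant to have. -/
theorem HypergroupData.deform_conv_apply {D : Type*} [TopologicalSpace D]
    [SecondCountableTopology D] [MeasurableSpace D] [BorelSpace D]
    (H : HypergroupData D) [IsMarkovKernel H.conv] (α : D → ℝ) (hα : Continuous α) (x y : D) :
    (H.deform α).conv (x, y) =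
      (H.conv (x, y)).withDensity fun t => ENNReal.ofReal (α t / (α x * α y)) := by
  have hm := hα.measurable
  exact Kernel.withDensity_apply H.conv (by unfold Function.uncurry; fun_prop) (x, y)

/-- The deformed kernel is given by the formula it is meant to have. -/
theorem deformKernel_apply {X D : Type*} [TopologicalSpace X] [SecondCountableTopology X]
    [MeasurableSpace X] [BorelSpace X] [TopologicalSpace D] [SecondCountableTopology D]
    [MeasurableSpace D] [BorelSpace D] (K : Kernel (X × D) X) [IsMarkovKernel K]
    (α : D → ℝ) (φ : X → ℝ) (hα : Continuous α) (hφ : Continuous φ)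
    (hα0 : ∀ h, 0 < α h) (hφ0 : ∀ x, 0 < φ x) (x : X) (h : D) (A : Set X) :
    deformKernel K α φ (x, h) A =
      ENNReal.ofReal (1 / (α h * φ x)) * ∫⁻ y in A, ENNReal.ofReal (φ y) ∂(K (x, h)) := by
  have hm := hα.measurable
  have hm' := hφ.measurable
  rw [deformKernel, Kernel.withDensity_apply' K (by unfold Function.uncurry; fun_prop) (x, h) A,
    ← lintegral_const_mul _ (by fun_prop)]
  refine lintegral_congr fun y => ?_
  have := mul_pos (hα0 h) (hφ0 x)
  rw [← ENNReal.ofReal_mul (by positivity)]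
  congr 1
  ring

/-! The deformation is a Doob transform. With `M` the multiplication by `φ₀`, the deformed operators
are `α₀(h)⁻¹ M⁻¹ T_h M`. Conjugation respects products, so in the composition formula only the
scalars `α₀` survive, and they form exactly the density of the deformed convolution. Associativity
holds by the same cancellation. Applying the composition formula to `φ₀` shows that `α₀` is
multiplicative on the hypergroup (`isPositiveSemicharacter_hypergroup`); hence the deformed
convolutions have mass one. A positive density does not change supports, so all axioms on supports
are inherited. Identities of measures are tested against `[0, ∞]`-valued functions, which avoids
integrability questions. As `α₀` and `φ₀` may be unbounded, continuity and (T1) are first extended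
to all continuous functions by cutting off near the compact supports
(`IsContinuousKernel.continuous_integral`, `HasT1At.integral_eq`). Then (T1) for `α₀` gives the
eigenvalue equation of `α₀ ∘ π_z`, and (T1) for `α₀ f` gives the deformed (T1). -/

/-! ### Measures with a positive continuous density. -/

section Density

variable {T : Type*} [TopologicalSpace T] [MeasurableSpace T] [OpensMeasurableSpace T]

/-- A strictly positive density makes the two measures mutually absolutely continuous. -/
theorem support_withDensity_ofReal (μ : Measure T) {φ : T → ℝ} (hφ : Continuous φ)
    (hpos : ∀ t, 0 < φ t) :
    (μ.withDensity fun t => ENNReal.ofReal (φ t)).support = μ.support := by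
  have hm := hφ.measurable
  refine (withDensity_absolutelyContinuous _ _).support_mono.antisymm
    (withDensity_absolutelyContinuous' (by fun_prop) ?_).support_mono
  exact .of_forall fun t => by simpa using hpos t

/-- Integrals against `φ / c · μ`. -/
theorem lintegral_withDensity_div (μ : Measure T) {φ : T → ℝ} (hφ : Continuous φ)
    {c : ℝ} (hc : 0 < c) {f : T → ℝ≥0∞} (hf : Measurable f) :
    ∫⁻ t, f t ∂(μ.withDensity fun t => ENNReal.ofReal (φ t / c)) =
      (ENNReal.ofReal c)⁻¹ * ∫⁻ t, ENNReal.ofReal (φ t) * f t ∂μ := by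
  have hm := hφ.measurable
  rw [lintegral_withDensity_eq_lintegral_mul _ (by fun_prop) hf, ← lintegral_const_mul _ (by fun_prop)]
  refine lintegral_congr fun t => ?_
  rw [Pi.mul_apply, ENNReal.ofReal_div_of_pos hc, ENNReal.div_eq_inv_mul, mul_assoc]

/-- No integrability is required: if one integrand is not integrable, neither is the other, and both
integrals are `0` by convention. -/
theorem integral_withDensity_div (μ : Measure T) {φ : T → ℝ} (hφ : Continuous φ)
    (hpos : ∀ t, 0 < φ t) {c : ℝ} (hc : 0 < c) (f : T → ℂ) :
    ∫ t, f t ∂(μ.withDensity fun t => ENNReal.ofReal (φ t / c)) =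
      (c : ℂ)⁻¹ * ∫ t, (φ t : ℂ) * f t ∂μ := by
  have hm := hφ.measurable
  rw [integral_withDensity_eq_integral_toReal_smul (by fun_prop) (by simp),
    ← integral_const_mul]
  refine integral_congr_ae (.of_forall fun t => ?_)
  have : 0 ≤ φ t / c := (div_pos (hpos t) hc).le
  simp only [ENNReal.toReal_ofReal this, Complex.real_smul]
  push_cast
  ring

end Density

section Supports

variable {S T : Type*} [TopologicalSpace S] [MeasurableSpace S] [TopologicalSpace T]
  [MeasurableSpace T] {κ : Kernel S T}

theorem HasContinuousCompactSupports.isCompact_support (h : HasContinuousCompactSupports κ)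
    (s : S) : IsCompact (κ s).support := by
  obtain ⟨c, -, hc⟩ := h
  exact hc s ▸ (c s).isCompact

theorem HasContinuousCompactSupports.congr_support (h : HasContinuousCompactSupports κ)
    {κ' : Kernel S T} (h' : ∀ s, (κ' s).support = (κ s).support) :
    HasContinuousCompactSupports κ' := by
  obtain ⟨C, hC, hs⟩ := h
  exact ⟨C, hC, fun s => by rw [hs, h']⟩

end Supports

/-! ### Cutting off unbounded continuous functions near compact supports. -/

section Cutoff

variable {T : Type*} [TopologicalSpace T] [T2Space T] [LocallyCompactSpace T]

theorem exists_hasCompactSupport_eqOn {f : T → ℂ} (hf : Continuous f) {C : Set T}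
    (hC : IsCompact C) :
    ∃ g : T → ℂ, Continuous g ∧ HasCompactSupport g ∧ ∀ t ∈ C, g t = f t := by
  obtain ⟨χ, h1, -, h2, -⟩ := exists_continuous_one_zero_of_isCompact hC isClosed_empty
    (Set.disjoint_empty C)
  refine ⟨fun t => (χ t : ℂ) * f t, by fun_prop, ?_, fun t ht => by simp [h1 ht]⟩
  refine HasCompactSupport.mul_right (f := fun t => (χ t : ℂ)) ?_
  exact h2.comp_left (g := fun r : ℝ => (r : ℂ)) (by simp)

variable {S : Type*} [TopologicalSpace S] [MeasurableSpace S] [SecondCountableTopology T]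
  [MeasurableSpace T] [OpensMeasurableSpace T] {κ : Kernel S T}

omit [OpensMeasurableSpace T] in
/-- Continuous kernels with continuous compact supports preserve continuity of unbounded functions. -/
theorem IsContinuousKernel.continuous_integral (hκ : IsContinuousKernel κ)
    (hs : HasContinuousCompactSupports κ) {f : T → ℂ} (hf : Continuous f) :
    Continuous fun s => ∫ t, f t ∂(κ s) := by
  obtain ⟨c, hc, hcs⟩ := hs
  refine continuous_iff_continuousAt.2 fun s₀ => ?_
  obtain ⟨C, hC, hsub⟩ := exists_compact_superset (c s₀).isCompact
  obtain ⟨g, hg, hg0, hgf⟩ := exists_hasCompactSupport_eqOn hf hC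
  obtain ⟨B, hB⟩ := hg0.exists_bound_of_continuous hg
  have h1 := hκ (BoundedContinuousFunction.ofNormedAddCommGroup g hg B hB)
  refine h1.continuousAt.congr ?_
  -- In the Vietoris topology the compact sets inside a given open set form an open set. So for `s`
  -- near `s₀` all supports lie in `C`, where `f` agrees with the bounded `g`.
  have h2 : ∀ᶠ s in nhds s₀, (c s : Set T) ⊆ interior C :=
    hc.continuousAt.eventually
      ((TopologicalSpace.Compacts.isOpen_subsets_of_isOpen isOpen_interior).mem_nhds hsub)
  filter_upwards [h2] with s hs
  refine integral_congr_ae ?_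
  filter_upwards [(κ s).support_mem_ae] with t ht
  exact hgf t (interior_subset (hs (hcs s ▸ ht)))

theorem HasContinuousCompactSupports.integrable [IsFiniteKernel κ]
    (h : HasContinuousCompactSupports κ) {f : T → ℂ} (hf : Continuous f) (s : S) :
    Integrable f (κ s) := by
  obtain ⟨g, hg, hg0, hgf⟩ := exists_hasCompactSupport_eqOn hf (h.isCompact_support s)
  refine (hg.integrable_of_hasCompactSupport hg0).congr ?_
  filter_upwards [(κ s).support_mem_ae] with t ht using hgf t ht

/-- Real eigenfunction equations in terms of lower integrals. -/
theorem HasContinuousCompactSupports.lintegral_ofReal [IsFiniteKernel κ]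
    (h : HasContinuousCompactSupports κ) {f : T → ℝ} (hf : Continuous f) (hpos : ∀ t, 0 < f t)
    (s : S) : ∫⁻ t, ENNReal.ofReal (f t) ∂(κ s) = ENNReal.ofReal (∫ t, f t ∂(κ s)) := by
  have hi := h.integrable (f := fun t => (f t : ℂ)) (by fun_prop) s
  exact (ofReal_integral_eq_lintegral_ofReal (by simpa using hi.re)
    (.of_forall fun t => (hpos t).le)).symm

variable {φ : T → ℝ} {c : S → ℝ}

/-- The new operator sends `f` to the integral of `φ f` divided by `c`; `φ f` may be unbounded,
which is why the supports enter. -/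
theorem IsContinuousKernel.of_withDensity_div (hκ : IsContinuousKernel κ)
    (hs : HasContinuousCompactSupports κ) (hφ : Continuous φ) (hpos : ∀ t, 0 < φ t)
    (hc : Continuous c) (hc0 : ∀ s, 0 < c s) {κ' : Kernel S T}
    (h : ∀ s, κ' s = (κ s).withDensity fun t => ENNReal.ofReal (φ t / c s)) :
    IsContinuousKernel κ' := by
  intro f
  simp only [h, integral_withDensity_div _ hφ hpos (hc0 _)]
  refine Continuous.mul ?_ (hκ.continuous_integral hs (by fun_prop))
  exact Continuous.inv₀ (by fun_prop) fun s => by exact_mod_cast (hc0 s).ne'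

end Cutoff

/-! ### Reduction of associativity and commutativity to point measures. -/

namespace HypergroupData

variable {D : Type*} [MeasurableSpace D] (H : HypergroupData D)

theorem lintegral_mul (μ ν : Measure D) [SFinite μ] [SFinite ν] {f : D → ℝ≥0∞} (hf : Measurable f) :
    ∫⁻ t, f t ∂(H.mul μ ν) = ∫⁻ x, ∫⁻ y, ∫⁻ t, f t ∂(H.conv (x, y)) ∂ν ∂μ := by
  rw [mul, Measure.lintegral_bind H.conv.measurable.aemeasurable hf.aemeasurable,
    lintegral_prod _ (hf.lintegral_kernel).aemeasurable]

instance isFiniteMeasure_mul [IsMarkovKernel H.conv] (μ ν : Measure D) [IsFiniteMeasure μ] [IsFiniteMeasure ν] :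
    IsFiniteMeasure (H.mul μ ν) := by
  unfold mul
  infer_instance

theorem mul_dirac_dirac (x y : D) : H.mul (.dirac x) (.dirac y) = H.conv (x, y) := by
  rw [mul, Measure.dirac_prod_dirac, Measure.dirac_bind H.conv.measurable]

/-- Associativity on point measures, tested against measurable functions. -/
theorem assoc_iff [IsMarkovKernel H.conv] :
    (∀ (μ ν ρ : Measure D) [IsFiniteMeasure μ] [IsFiniteMeasure ν] [IsFiniteMeasure ρ],
      H.mul (H.mul μ ν) ρ = H.mul μ (H.mul ν ρ)) ↔
    ∀ (x y z : D) (f : D → ℝ≥0∞), Measurable f →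
      ∫⁻ s, ∫⁻ t, f t ∂(H.conv (s, z)) ∂(H.conv (x, y)) =
        ∫⁻ s, ∫⁻ t, f t ∂(H.conv (x, s)) ∂(H.conv (y, z)) := by
  constructor
  · intro h x y z f hf
    have h1 := congrArg (fun μ => ∫⁻ t, f t ∂μ) (h (.dirac x) (.dirac y) (.dirac z))
    simp only [mul_dirac_dirac, H.lintegral_mul _ _ hf] at h1
    have hm : Measurable fun p : D × D => ∫⁻ t, f t ∂(H.conv p) := hf.lintegral_kernel
    rw [lintegral_dirac' _ (by fun_prop)] at h1
    convert h1 using 2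
    funext s
    rw [lintegral_dirac' _ (by fun_prop)]
  · intro h μ ν ρ _ _ _
    refine Measure.ext_of_lintegral _ fun f hf => ?_
    have hm : Measurable fun p : D × D => ∫⁻ t, f t ∂(H.conv p) := hf.lintegral_kernel
    rw [H.lintegral_mul _ _ hf, H.lintegral_mul _ _ hf, H.lintegral_mul _ _ (by fun_prop)]
    refine lintegral_congr fun x => ?_
    rw [H.lintegral_mul _ _ (by fun_prop)]
    refine lintegral_congr fun y => ?_
    -- Tonelli moves the integration over `ρ` outside that over `H.conv (x, y)`.
    rw [lintegral_lintegral_swap hm.aemeasurable]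
    exact lintegral_congr fun z => h x y z f hf

theorem isCommutative_iff [IsMarkovKernel H.conv] : H.IsCommutative ↔ ∀ x y, H.conv (x, y) = H.conv (y, x) := by
  constructor
  · intro h x y
    simpa only [mul_dirac_dirac] using h (.dirac x) (.dirac y)
  · intro h μ ν _ _
    refine Measure.ext_of_lintegral _ fun f hf => ?_
    have hm : Measurable fun p : D × D => ∫⁻ t, f t ∂(H.conv p) := hf.lintegral_kernel
    rw [H.lintegral_mul _ _ hf, H.lintegral_mul _ _ hf, lintegral_lintegral_swap hm.aemeasurable]
    simp only [h]

end HypergroupData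

/-- In an iterated deformation, the outer density at the intermediate point cancels the matching
factor of the inner normalization. -/
theorem ENNReal.ofReal_mul_inv_ofReal_mul {a b : ℝ} (ha : 0 < a) (x : ℝ≥0∞) :
    ENNReal.ofReal a * ((ENNReal.ofReal (a * b))⁻¹ * x) = (ENNReal.ofReal b)⁻¹ * x := by
  have h0 : ENNReal.ofReal a ≠ 0 := by simpa using ha
  rw [ENNReal.ofReal_mul ha.le, ENNReal.mul_inv (.inl h0) (.inl ENNReal.ofReal_ne_top), ← mul_assoc,
    ← mul_assoc, ENNReal.mul_inv_cancel h0 ENNReal.ofReal_ne_top, one_mul]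

/-! ### The deformed hypergroup. -/

namespace HypergroupData

variable {D : Type*} [TopologicalSpace D] [SecondCountableTopology D] [MeasurableSpace D]
  [BorelSpace D] (H : HypergroupData D) [IsMarkovKernel H.conv] {α : D → ℝ}

theorem lintegral_deform_conv (hα : Continuous α) (hpos : ∀ t, 0 < α t) (x y : D)
    {f : D → ℝ≥0∞} (hf : Measurable f) :
    ∫⁻ t, f t ∂((H.deform α).conv (x, y)) =
      (ENNReal.ofReal (α x * α y))⁻¹ * ∫⁻ t, ENNReal.ofReal (α t) * f t ∂(H.conv (x, y)) := by
  rw [deform_conv_apply H α hα, lintegral_withDensity_div _ hα (mul_pos (hpos x) (hpos y)) hf]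

theorem support_deform_conv (hα : Continuous α) (hpos : ∀ t, 0 < α t) (p : D × D) :
    ((H.deform α).conv p).support = (H.conv p).support := by
  rw [deform_conv_apply H α hα]
  exact support_withDensity_ofReal _ (by fun_prop) fun t =>
    div_pos (hpos t) (mul_pos (hpos _) (hpos _))

theorem IsCommutative.deform_conv_comm (hcomm : H.IsCommutative) (hα : Continuous α) (x y : D) :
    (H.deform α).conv (x, y) = (H.deform α).conv (y, x) := by
  rw [deform_conv_apply H α hα, deform_conv_apply H α hα, H.isCommutative_iff.1 hcomm x y,
    mul_comm (α x)]

variable {H}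

variable [T2Space D]

omit [SecondCountableTopology D] [IsMarkovKernel H.conv] in
-- Since `δ_e * δ_e = δ_e`, the positive number `α(e)` equals its square.
theorem IsPositiveSemicharacter.map_one (hα : H.IsPositiveSemicharacter α) (hH : H.IsHypergroup) :
    α H.one = 1 := by
  have h := hα.multiplicative H.one H.one
  rw [hH.conv_one, integral_dirac] at h
  have := hα.pos H.one
  nlinarith

variable [LocallyCompactSpace D]

theorem IsPositiveSemicharacter.lintegral_eq (hα : H.IsPositiveSemicharacter α)
    (hH : H.IsHypergroup) (x y : D) :
    ∫⁻ t, ENNReal.ofReal (α t) ∂(H.conv (x, y)) = ENNReal.ofReal (α x * α y) := by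
  rw [hH.compact_supports.lintegral_ofReal hα.continuous hα.pos, hα.multiplicative]

theorem IsPositiveSemicharacter.isMarkovKernel_deform (hα : H.IsPositiveSemicharacter α)
    (hH : H.IsHypergroup) : IsMarkovKernel (H.deform α).conv := by
  refine ⟨fun ⟨x, y⟩ => ⟨?_⟩⟩
  have h := H.lintegral_deform_conv hα.continuous hα.pos x y (f := fun _ => 1) measurable_const
  have h0 := mul_pos (hα.pos x) (hα.pos y)
  simpa [hα.lintegral_eq hH, ENNReal.inv_mul_cancel, h0] using h

/-- Deformation by a positive semicharacter yields a hypergroup. -/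
theorem IsPositiveSemicharacter.isHypergroup_deform (hα : H.IsPositiveSemicharacter α)
    (hH : H.IsHypergroup) : (H.deform α).IsHypergroup := by
  have hM := hα.isMarkovKernel_deform hH
  have hαc := hα.continuous
  have hαm := hα.continuous.measurable
  have hconv := fun x y => deform_conv_apply H α hα.continuous x y
  -- The density takes the value `1` at the only point that is charged. With `α(e) = 1` this yields
  -- both unit laws.
  have hone (x : D) : (Measure.dirac x).withDensity (fun t => ENNReal.ofReal (α t / α x)) =
      Measure.dirac x := by
    refine Measure.ext_of_lintegral _ fun f hf => ?_
    rw [lintegral_withDensity_div _ hα.continuous (hα.pos x) hf, lintegral_dirac' _ (by fun_prop),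
      lintegral_dirac' _ hf, ← mul_assoc, ENNReal.inv_mul_cancel (by simpa using hα.pos x) (by simp),
      one_mul]
  refine ⟨hM, ?_, ?_, ?_, fun x => ?_, fun x => ?_, hH.inv_continuous, hH.inv_inv, ?_, ?_⟩
  · exact hH.weakly_continuous.of_withDensity_div hH.compact_supports hα.continuous hα.pos
      (c := fun p : D × D => α p.1 * α p.2) (by fun_prop) (fun p => mul_pos (hα.pos _) (hα.pos _))
      fun p => hconv _ _
  · refine (H.deform α).assoc_iff.2 fun x y z f hf => ?_
    have hm : Measurable fun p : D × D => ∫⁻ t, f t ∂((H.deform α).conv p) := hf.lintegral_kernel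
    have hm' : Measurable fun p : D × D => ∫⁻ t, ENNReal.ofReal (α t) * f t ∂(H.conv p) :=
      Measurable.lintegral_kernel (by fun_prop)
    -- Once the intermediate weights cancel, both sides are `(α(x) α(y) α(z))⁻¹` times an undeformed
    -- iterated integral of `α f`.
    have key := H.assoc_iff.1 hH.assoc x y z (fun t => ENNReal.ofReal (α t) * f t) (by fun_prop)
    rw [H.lintegral_deform_conv hα.continuous hα.pos _ _ (by fun_prop),
      H.lintegral_deform_conv hα.continuous hα.pos _ _ (by fun_prop)]
    simp only [H.lintegral_deform_conv hα.continuous hα.pos _ _ hf, mul_comm (α x),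
      ENNReal.ofReal_mul_inv_ofReal_mul (hα.pos _)]
    rw [lintegral_const_mul _ (by fun_prop), lintegral_const_mul _ (by fun_prop), key,
      ← mul_assoc, ← mul_assoc]
    congr 1
    have h1 (t : D) : ENNReal.ofReal (α t) ≠ 0 := by simpa using hα.pos t
    have h2 (t : D) : (ENNReal.ofReal (α t)) ≠ ∞ := ENNReal.ofReal_ne_top
    simp only [ENNReal.ofReal_mul (hα.pos _).le, ENNReal.mul_inv (.inl (h1 _)) (.inl (h2 _))]
    ring
  · exact hH.compact_supports.congr_support fun p =>
      H.support_deform_conv hα.continuous hα.pos p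
  · change (H.deform α).conv (x, H.one) = _
    rw [hconv, hH.conv_one, hα.map_one hH, mul_one, hone]
  · change (H.deform α).conv (H.one, x) = _
    rw [hconv, hH.one_conv, hα.map_one hH, one_mul, hone]
  · intro x y
    rw [H.support_deform_conv hα.continuous hα.pos]
    exact hH.one_mem_support_iff x y
  · intro x y
    change ((H.deform α).conv (x, y)).map H.inv = (H.deform α).conv (H.inv y, H.inv x)
    have hi := hH.inv_continuous.measurable
    refine Measure.ext_of_lintegral _ fun f hf => ?_
    -- Density and normalization are both unchanged by the involution, because `α(x̄) = α(x)`.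
    rw [lintegral_map hf hi, H.lintegral_deform_conv hα.continuous hα.pos _ _ (by fun_prop),
      H.lintegral_deform_conv hα.continuous hα.pos _ _ hf, ← hH.conv_map_inv,
      lintegral_map (by fun_prop) hi, hα.inv, hα.inv, mul_comm (α y)]
    simp only [hα.inv]

end HypergroupData

/-! ### Positive semicharacters of a scheme, in real form. -/

namespace IsPositiveSemicharacter

variable {X D : Type*} [TopologicalSpace X] [MeasurableSpace X] [TopologicalSpace D]
  [MeasurableSpace D] {H : HypergroupData D} {K : Kernel (X × D) X} {α : D → ℝ} {φ : X → ℝ}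

theorem continuous_left (hp : IsPositiveSemicharacter H K α φ) : Continuous α :=
  Complex.continuous_re.comp hp.semicharacter.continuous_left

theorem continuous_right (hp : IsPositiveSemicharacter H K α φ) : Continuous φ :=
  Complex.continuous_re.comp hp.semicharacter.continuous_right

theorem inv (hp : IsPositiveSemicharacter H K α φ) (h : D) : α (H.inv h) = α h := by
  simpa using congrArg Complex.re (hp.semicharacter.inv h)

theorem integral_eq (hp : IsPositiveSemicharacter H K α φ) (h : D) (x : X) :
    ∫ y, φ y ∂(K (x, h)) = φ x * α h := by
  have := hp.semicharacter.eigen h x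
  rw [integral_complex_ofReal] at this
  exact_mod_cast this

end IsPositiveSemicharacter

/-- The composition formula of a scheme, tested against measurable functions. -/
theorem IsCAS.lintegral_comp {X D : Type*} [TopologicalSpace X] [MeasurableSpace X]
    [TopologicalSpace D] [MeasurableSpace D] {H : HypergroupData D} {K : Kernel (X × D) X}
    {π : X → X → D} (hK : IsCAS H K π) (h₁ h₂ : D) (x : X) {f : X → ℝ≥0∞} (hf : Measurable f) :
    ∫⁻ y, ∫⁻ w, f w ∂(K (y, h₂)) ∂(K (x, h₁)) =
      ∫⁻ h, ∫⁻ w, f w ∂(K (x, h)) ∂(H.conv (h₁, h₂)) := by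
  have h1 : Measurable fun y => K (y, h₂) := K.measurable.comp (by fun_prop)
  have h2 : Measurable fun h => K (x, h) := K.measurable.comp (by fun_prop)
  have key : (K (x, h₁)).bind (fun y => K (y, h₂)) =
      (H.conv (h₁, h₂)).bind fun h => K (x, h) := by
    ext A hA
    rw [Measure.bind_apply hA h1.aemeasurable, Measure.bind_apply hA h2.aemeasurable,
      hK.comp_eq _ _ _ _ hA]
  have := congrArg (fun μ => ∫⁻ w, f w ∂μ) key
  rwa [Measure.lintegral_bind h1.aemeasurable hf.aemeasurable,
    Measure.lintegral_bind h2.aemeasurable hf.aemeasurable] at this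

/-! ### The deformed scheme and its invariant measures. -/

section DeformKernel

variable {X D : Type*} [TopologicalSpace X] [SecondCountableTopology X] [MeasurableSpace X]
  [BorelSpace X] [TopologicalSpace D] [SecondCountableTopology D] [MeasurableSpace D]
  [BorelSpace D] {H : HypergroupData D} [IsMarkovKernel H.conv]
  {K : Kernel (X × D) X} [IsMarkovKernel K] {π : X → X → D} {α : D → ℝ} {φ : X → ℝ}

omit [SecondCountableTopology X] [SecondCountableTopology D] in
theorem deformKernel_eq_withDensity (hα : Continuous α) (hφ : Continuous φ) (x : X) (h : D) :
    deformKernel K α φ (x, h) =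
      (K (x, h)).withDensity fun y => ENNReal.ofReal (φ y / (α h * φ x)) := by
  have hm := hα.measurable
  have hm' := hφ.measurable
  exact Kernel.withDensity_apply K (by unfold Function.uncurry; fun_prop) (x, h)

namespace IsPositiveSemicharacter

omit [SecondCountableTopology X] [SecondCountableTopology D] [IsMarkovKernel H.conv] in
theorem lintegral_deformKernel (hp : IsPositiveSemicharacter H K α φ) (x : X) (h : D)
    {f : X → ℝ≥0∞} (hf : Measurable f) :
    ∫⁻ y, f y ∂(deformKernel K α φ (x, h)) =
      (ENNReal.ofReal (α h * φ x))⁻¹ * ∫⁻ y, ENNReal.ofReal (φ y) * f y ∂(K (x, h)) := by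
  rw [deformKernel_eq_withDensity hp.continuous_left hp.continuous_right,
    lintegral_withDensity_div _ hp.continuous_right (mul_pos (hp.pos_left h) (hp.pos_right x)) hf]

omit [SecondCountableTopology X] [SecondCountableTopology D] [IsMarkovKernel H.conv] in
theorem integral_deformKernel (hp : IsPositiveSemicharacter H K α φ) (x : X) (h : D) (f : X → ℂ) :
    ∫ y, f y ∂(deformKernel K α φ (x, h)) =
      ((α h * φ x : ℝ) : ℂ)⁻¹ * ∫ y, (φ y : ℂ) * f y ∂(K (x, h)) := by
  rw [deformKernel_eq_withDensity hp.continuous_left hp.continuous_right,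
    integral_withDensity_div _ hp.continuous_right hp.pos_right
      (mul_pos (hp.pos_left h) (hp.pos_right x))]

omit [SecondCountableTopology X] [SecondCountableTopology D] [IsMarkovKernel H.conv] in
theorem support_deformKernel (hp : IsPositiveSemicharacter H K α φ) (p : X × D) :
    (deformKernel K α φ p).support = (K p).support := by
  have hφ := hp.continuous_right
  rw [deformKernel_eq_withDensity hp.continuous_left hφ]
  exact support_withDensity_ofReal _ (by fun_prop) fun t =>
    div_pos (hp.pos_right t) (mul_pos (hp.pos_left _) (hp.pos_right _))

variable [T2Space X] [LocallyCompactSpace X]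

omit [SecondCountableTopology D] in
/-- If `ω` is invariant for a scheme, then `φ² · ω` is invariant for its deformation. -/
theorem isInvariantMeasure_deform (hp : IsPositiveSemicharacter H K α φ) {ω : Measure X}
    (hω : IsInvariantMeasure H K ω) :
    IsInvariantMeasure (H.deform α) (deformKernel K α φ)
      (ω.withDensity fun x => ENNReal.ofReal (φ x ^ 2)) := by
  have hφ := hp.continuous_right
  have hφ0 := hp.pos_right
  have hreg := hω.regular
  refine ⟨?_, ?_, ?_⟩
  -- Local finiteness suffices, since `X` is second countable, locally compact and Hausdorff.
  · have := IsLocallyFiniteMeasure.withDensity_ofReal (μ := ω) (hφ.pow 2)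
    infer_instance
  · rw [support_withDensity_ofReal (φ := fun x => φ x ^ 2) _ (hφ.pow 2) fun x => pow_pos (hφ0 x) 2, hω.support_eq]
  · intro h f g hf hf0 hg hg0
    have hint (F : X → ℂ) : ∫ x, F x ∂(ω.withDensity fun x => ENNReal.ofReal (φ x ^ 2)) =
        ∫ x, (φ x : ℂ) ^ 2 * F x ∂ω := by
      simpa using integral_withDensity_div ω (hφ.pow 2) (fun x => pow_pos (hφ0 x) 2) one_pos F
    -- Of the two factors in `φ²`, one cancels the `φ(x)⁻¹` of the deformed kernel and the other
    -- multiplies the function outside it. This leaves the old adjoint relation for `φ f` and `φ g`,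
    -- up to `α(h)⁻¹ = α(h̄)⁻¹`.
    have key := hω.adjoint h (fun x => φ x * f x) (fun x => φ x * g x) (by fun_prop)
      hf0.mul_left (by fun_prop) hg0.mul_left
    have hφne (x : X) : (φ x : ℂ) ≠ 0 := by exact_mod_cast (hφ0 x).ne'
    have hαne : (α h : ℂ) ≠ 0 := by exact_mod_cast (hp.pos_left h).ne'
    change ∫ x, (∫ y, f y ∂(deformKernel K α φ (x, H.inv h))) * g x ∂_ = _
    simp only [hp.integral_deformKernel, hp.inv]
    rw [hint, hint]
    calc _ = (α h : ℂ)⁻¹ *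
          ∫ x, (∫ y, φ y * f y ∂(K (x, H.inv h))) * (φ x * g x) ∂ω := by
          rw [← integral_const_mul]
          refine integral_congr_ae (.of_forall fun x => ?_)
          have := hφne x
          push_cast
          field_simp
      _ = _ := by
          rw [key, ← integral_const_mul]
          refine integral_congr_ae (.of_forall fun x => ?_)
          have := hφne x
          push_cast
          field_simp

omit [SecondCountableTopology D] [BorelSpace D] [IsMarkovKernel H.conv] in
theorem lintegral_eq (hp : IsPositiveSemicharacter H K α φ) (hK : IsCAS H K π) (x : X) (h : D) :
    ∫⁻ y, ENNReal.ofReal (φ y) ∂(K (x, h)) = ENNReal.ofReal (φ x) * ENNReal.ofReal (α h) := by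
  rw [hK.compact_supports.lintegral_ofReal hp.continuous_right hp.pos_right, hp.integral_eq,
    ENNReal.ofReal_mul (hp.pos_right x).le]

variable [T2Space D] [LocallyCompactSpace D]

/-- The first component of a positive semicharacter of a scheme is one of the hypergroup. -/
theorem isPositiveSemicharacter_hypergroup [Nonempty X] (hp : IsPositiveSemicharacter H K α φ)
    (hK : IsCAS H K π) : H.IsPositiveSemicharacter α := by
  refine ⟨hp.continuous_left, hp.pos_left, fun h₁ h₂ => ?_, hp.inv⟩
  have hmα := hp.continuous_left.measurable
  have hmφ := hp.continuous_right.measurable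
  obtain ⟨x⟩ := ‹Nonempty X›
  -- Evaluated on `φ`, the two sides are `φ(x) α(h₁) α(h₂)` and `φ(x) ∫ α d(δ_{h₁} * δ_{h₂})`; one
  -- point `x` is enough, as `φ(x)` can be cancelled.
  have key := hK.lintegral_comp h₁ h₂ x (f := fun y => ENNReal.ofReal (φ y)) (by fun_prop)
  simp only [hp.lintegral_eq hK] at key
  rw [lintegral_mul_const _ (by fun_prop), lintegral_const_mul _ (by fun_prop), hp.lintegral_eq hK,
    hK.isHypergroup.compact_supports.lintegral_ofReal hp.continuous_left hp.pos_left, mul_assoc,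
    ENNReal.mul_right_inj (by simpa using hp.pos_right x) ENNReal.ofReal_ne_top,
    ← ENNReal.ofReal_mul (hp.pos_left _).le] at key
  refine ((ENNReal.ofReal_eq_ofReal_iff ?_ ?_).1 key).symm
  · exact (mul_pos (hp.pos_left _) (hp.pos_left _)).le
  · exact integral_nonneg fun t => (hp.pos_left t).le

/-- Deformation by a positive semicharacter yields a continuous association scheme. -/
theorem isCAS_deform [Nonempty X] (hp : IsPositiveSemicharacter H K α φ) (hK : IsCAS H K π) :
    IsCAS (H.deform α) (deformKernel K α φ) π := by
  have hα := hp.continuous_left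
  have hφ := hp.continuous_right
  have hmα := hα.measurable
  have hmφ := hφ.measurable
  have hH := hp.isPositiveSemicharacter_hypergroup hK
  have hα0 (h : D) : ENNReal.ofReal (α h) ≠ 0 := by simpa using hp.pos_left h
  have hφ0 (x : X) : ENNReal.ofReal (φ x) ≠ 0 := by simpa using hp.pos_right x
  have hpos (x : X) (h : D) : 0 < α h * φ x := mul_pos (hp.pos_left h) (hp.pos_right x)
  refine ⟨⟨fun ⟨x, h⟩ => ⟨?_⟩⟩, ?_, ?_, ?_, hK.continuous_proj,
    hH.isHypergroup_deform hK.isHypergroup, ?_, ?_, ?_⟩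
  · have h1 := hp.lintegral_deformKernel x h (f := fun _ => 1) measurable_const
    simp only [lintegral_one, mul_one, hp.lintegral_eq hK] at h1
    rw [h1, mul_comm (ENNReal.ofReal (φ x)), ← ENNReal.ofReal_mul (hp.pos_left h).le,
      ENNReal.inv_mul_cancel (by simpa using hpos x h) ENNReal.ofReal_ne_top]
  · exact hK.isContinuous.of_withDensity_div hK.compact_supports hφ hp.pos_right
      (c := fun p : X × D => α p.2 * φ p.1) (by fun_prop) (fun p => hpos _ _)
      fun p => deformKernel_eq_withDensity hα hφ _ _
  · exact hK.compact_supports.congr_support hp.support_deformKernel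
  · intro x y h
    rw [hp.support_deformKernel]
    exact hK.partition x y h
  · intro h₁ h₂ x A hA
    have h1 (x : X) (h : D) : deformKernel K α φ (x, h) A =
        (ENNReal.ofReal (α h * φ x))⁻¹ *
          ∫⁻ y, ENNReal.ofReal (φ y) * A.indicator 1 y ∂(K (x, h)) := by
      rw [← hp.lintegral_deformKernel x h (measurable_one.indicator hA), lintegral_indicator_one hA]
    have hm : Measurable fun y => ENNReal.ofReal (φ y) * A.indicator 1 y :=
      Measurable.mul (by fun_prop) (measurable_one.indicator hA)
    have hm' : Measurable fun p : X × D =>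
        ∫⁻ y, ENNReal.ofReal (φ y) * A.indicator 1 y ∂(K p) := hm.lintegral_kernel
    simp only [h1]
    rw [hp.lintegral_deformKernel _ _ (by fun_prop),
      H.lintegral_deform_conv hα hp.pos_left _ _ (by fun_prop)]
    -- The weight `φ` of the intermediate point cancels on the left, the weight `α` of the
    -- intermediate index on the right. Both sides keep the constant `(α(h₁) α(h₂) φ(x))⁻¹`.
    simp only [mul_comm (α h₂) (φ _), ENNReal.ofReal_mul_inv_ofReal_mul (hp.pos_left _),
      ENNReal.ofReal_mul_inv_ofReal_mul (hp.pos_right _)]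
    rw [lintegral_const_mul _ (by fun_prop), lintegral_const_mul _ (by fun_prop),
      hK.lintegral_comp _ _ _ hm, ← mul_assoc, ← mul_assoc]
    congr 1
    simp only [ENNReal.ofReal_mul (hp.pos_left _).le,
      ENNReal.mul_inv (.inl (hα0 _)) (.inl ENNReal.ofReal_ne_top)]
    ring
  · intro x
    change deformKernel K α φ (x, H.one) = _
    refine Measure.ext_of_lintegral _ fun f hf => ?_
    rw [hp.lintegral_deformKernel _ _ hf, hK.kernel_one, lintegral_dirac' _ (by fun_prop),
      lintegral_dirac' _ hf, hH.map_one hK.isHypergroup, one_mul, ← mul_assoc,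
      ENNReal.inv_mul_cancel (hφ0 x) ENNReal.ofReal_ne_top, one_mul]
  · obtain ⟨ω, hω⟩ := hK.exists_invariant
    exact ⟨_, hp.isInvariantMeasure_deform hω⟩

end IsPositiveSemicharacter

end DeformKernel

/-! ### Property (T1) and its deformation. -/

section TranslationProperty

variable {X D : Type*}
  [TopologicalSpace X] [T2Space X] [LocallyCompactSpace X] [SecondCountableTopology X]
  [MeasurableSpace X] [BorelSpace X]
  [TopologicalSpace D] [T2Space D] [LocallyCompactSpace D] [SecondCountableTopology D]
  [MeasurableSpace D] [BorelSpace D]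
  {H : HypergroupData D} {K : Kernel (X × D) X} {π : X → X → D} {z : X} {α : D → ℝ}

omit [T2Space X] [LocallyCompactSpace X] [BorelSpace X] [BorelSpace D] in
/-- The property (T1) extends from compactly supported to arbitrary continuous functions. -/
theorem HasT1At.integral_eq (hT : HasT1At H K π z) (hK : IsCAS H K π) (h : D) {f : D → ℂ}
    (hf : Continuous f) (y : X) :
    ∫ t, f t ∂(H.conv (π z y, h)) = ∫ w, f (π z w) ∂(K (y, h)) := by
  have hπ : Continuous (π z) := hK.continuous_proj.comp (Continuous.prodMk_right z)
  have h1 := hK.isHypergroup.compact_supports.isCompact_support (π z y, h)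
  have h2 := (hK.compact_supports.isCompact_support (y, h)).image hπ
  -- The cutoff must agree with `f` on the support of the convolution and on the `π_z`-image of the
  -- support of the kernel.
  obtain ⟨g, hg, hg0, hgf⟩ := exists_hasCompactSupport_eqOn hf (h1.union h2)
  calc _ = ∫ t, g t ∂(H.conv (π z y, h)) := by
        refine integral_congr_ae ?_
        filter_upwards [(H.conv (π z y, h)).support_mem_ae] with t ht
        exact (hgf t (.inl ht)).symm
    _ = ∫ w, g (π z w) ∂(K (y, h)) := hT h g hg hg0 y
    _ = _ := by
        refine integral_congr_ae ?_
        filter_upwards [(K (y, h)).support_mem_ae] with w hw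
        exact hgf _ (.inr (Set.mem_image_of_mem _ hw))

omit [T2Space X] [LocallyCompactSpace X] [BorelSpace X] [BorelSpace D] in
-- Property (T1) for `f = α` turns multiplicativity of `α` into the eigenvalue equation.
theorem HasT1At.isPositiveSemicharacter (hT : HasT1At H K π z) (hK : IsCAS H K π)
    (hα : H.IsPositiveSemicharacter α) :
    IsPositiveSemicharacter H K α (fun x => α (π z x)) := by
  have hπ : Continuous (π z) := hK.continuous_proj.comp (Continuous.prodMk_right z)
  have hαc := hα.continuous
  refine ⟨⟨⟨by fun_prop, by fun_prop, ?_, fun h x => ?_⟩, fun h => ?_⟩, hα.pos, fun x => hα.pos _⟩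
  · intro h0
    have h1 : (α H.one : ℂ) = 0 := congrFun h0 H.one
    exact (hα.pos H.one).ne' (by exact_mod_cast h1)
  · rw [← hT.integral_eq hK h (f := fun t => (α t : ℂ)) (by fun_prop), integral_complex_ofReal,
      hα.multiplicative]
    push_cast
    rfl
  · simp [hα.inv]

omit [T2Space X] [LocallyCompactSpace X] in
-- This is (T1) for `α f`: with `φ = α ∘ π_z` both normalizations are `α(π_z(y)) α(h)`.
theorem HasT1At.integral_deform [IsMarkovKernel H.conv] [IsMarkovKernel K] (hT : HasT1At H K π z)
    (hK : IsCAS H K π) (hα : H.IsPositiveSemicharacter α) (h : D) {f : D → ℂ} (hf : Continuous f)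
    (y : X) :
    ∫ t, f t ∂((H.deform α).conv (π z y, h)) =
      ∫ w, f (π z w) ∂(deformKernel K α (fun x => α (π z x)) (y, h)) := by
  have hαc := hα.continuous
  rw [(hT.isPositiveSemicharacter hK hα).integral_deformKernel,
    HypergroupData.deform_conv_apply H α hα.continuous,
    integral_withDensity_div _ hα.continuous hα.pos (mul_pos (hα.pos _) (hα.pos _)),
    hT.integral_eq hK h (f := fun t => α t * f t) (by fun_prop), mul_comm (α h)]

end TranslationProperty

theorem proposition8p6 {X D : Type*}
    [TopologicalSpace X] [T2Space X] [LocallyCompactSpace X] [SecondCountableTopology X]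
    [MeasurableSpace X] [BorelSpace X] [Nonempty X]
    [TopologicalSpace D] [T2Space D] [LocallyCompactSpace D] [SecondCountableTopology D]
    [MeasurableSpace D] [BorelSpace D]
    (H : HypergroupData D) [IsMarkovKernel H.conv]
    (K : Kernel (X × D) X) [IsMarkovKernel K] (π : X → X → D)
    (hK : IsCAS H K π) (hcomm : H.IsCommutative) :
    -- the deformed scheme, its hypergroup, and its invariant measures
    (∀ (α₀ : D → ℝ) (φ₀ : X → ℝ), IsPositiveSemicharacter H K α₀ φ₀ →
      IsCAS (H.deform α₀) (deformKernel K α₀ φ₀) π ∧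
      (H.deform α₀).IsCommutative ∧
      ∀ ω : Measure X, IsInvariantMeasure H K ω →
        IsInvariantMeasure (H.deform α₀) (deformKernel K α₀ φ₀)
          (ω.withDensity fun x => ENNReal.ofReal (φ₀ x ^ 2))) ∧
    -- the property (T1) at the base point of the semicharacter
    (HasT1 H K π → ∀ α₀ : D → ℝ, H.IsPositiveSemicharacter α₀ → ∀ z : X,
      IsPositiveSemicharacter H K α₀ (fun x => α₀ (π z x)) ∧
      (∀ f : D → ℂ, Continuous f → ∀ (h : D) (y : X),
        ∫ t, f t ∂((H.deform α₀).conv (h, π z y)) =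
          ∫ w, f (π z w) ∂(deformKernel K α₀ (fun x => α₀ (π z x)) (y, h))) ∧
      HasT1At (H.deform α₀) (deformKernel K α₀ (fun x => α₀ (π z x))) π z) := by
  refine ⟨fun α₀ φ₀ hp => ⟨hp.isCAS_deform hK, ?_, fun ω hω => hp.isInvariantMeasure_deform hω⟩,
    fun hT α₀ hα z => ⟨(hT z).isPositiveSemicharacter hK hα, fun f hf h y => ?_,
      fun h f hf _ y => (hT z).integral_deform hK hα h hf y⟩⟩
  · have := (hp.isPositiveSemicharacter_hypergroup hK).isMarkovKernel_deform hK.isHypergroup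
    exact (H.deform α₀).isCommutative_iff.2 (hcomm.deform_conv_comm H hp.continuous_left)
  -- Property (T1) has `h` as the right factor, so commutativity is needed to reach this order.
  · rw [hcomm.deform_conv_comm H hα.continuous]
    exact (hT z).integral_deform hK hα h hf y
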